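/- For an integer $k$, let $M_k(1)$ be the space of holomorphic modular forms of weight $k$ for $\mathrm{SL}_2(\mathbb{Z})$ (holomorphic on the upper half plane and at the cusp), and put $q=e^{2\pi i\tau}$. A form in $M_k(1)$ is called integral if all coefficients of its $q$-expansion are integers. Let $\eta(\tau)=q^{1/24}\prod_{n\ge1}(1-q^n)$ be the Dedekind eta function. For $F\in M_k(1)$ define $p(F,n)$ by $$\sum_{n=0}^\infty p(F,n)q^n=\frac{F(\tau)}{\prod_{n=1}^\infty(1-q^n)}.$$ Theorem. Let $\ell>3$ be a prime, let $k$ be a nonnegative even integer, and let $F\in M_k(1)$ be an integral modular form. Let $1\le\beta_\ell\le\ell-1$ be the integer with $24\beta_\ell\equiv1\pmod\ell$, and put $$r_\ell=\frac{24\beta_\ell-1}{\ell},\qquad \lambda_\ell=\frac{\ell^2+24\beta_\ell-1}{24\ell},$$ which are integers. Then there is an integral modular form $G_{\ell,F}\in M_{k+\ell-1-12\lambda_\ell}(1)$ such that $$\sum_{n=0}^\infty p(F,\ell n+\beta_\ell)\,q^{24n+r_\ell}\equiv\eta^{r_\ell}(24\tau)\,G_{\ell,F}(24\tau)\pmod\ell,$$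 meaning that both sides have integer coefficients as power series in $q$ and that corresponding coefficients are congruent modulo $\ell$. (If the weight $k+\ell-1-12\lambda_\ell$ is negative, then $G_{\ell,F}=0$.) -/

import Mathlib

open scoped UpperHalfPlane MatrixGroups ModularForm

namespace ChuaCongruence

/-- A level-one modular form is integral if all coefficients of its `q`-expansion are integers
(`q = exp (2 * π * i * τ)`). -/
def IsIntegralForm {k : ℤ} (F : ModularForm 𝒮ℒ k) : Prop :=
  ∀ n : ℕ, ∃ a : ℤ, (UpperHalfPlane.qExpansion 1 F).coeff n = (a : ℂ)

/-- The point `24 * τ` of the upper half plane. -/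
noncomputable def mul24 (τ : ℍ) : ℍ :=
  ⟨24 * (τ : ℂ), by simpa using τ.im_pos⟩

/-- The coefficients `p(F, n)` of
`F(τ) / ∏_{n ≥ 1} (1 - q ^ n) = ∑_{n ≥ 0} p(F, n) * q ^ n`, where `q = exp (2 * π * i * τ)`. -/
noncomputable def p (F : ℍ → ℂ) (n : ℕ) : ℂ :=
  (UpperHalfPlane.qExpansion 1
    fun τ : ℍ ↦ F τ / ∏' m : ℕ, (1 - Function.Periodic.qParam 1 (τ : ℂ) ^ (m + 1))).coeff n

/-- The power series `∑_{n ≥ 0} a n * q ^ (24 * n + r)`. -/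
noncomputable def series24 (r : ℕ) (a : ℕ → ℂ) : PowerSeries ℂ :=
  PowerSeries.X ^ r * PowerSeries.expand 24 (by norm_num) (PowerSeries.mk a)

/-- Two complex power series are congruent modulo `m`: both have integer coefficients, and
corresponding coefficients are congruent modulo `m`. -/
def SeriesCongr (m : ℕ) (f g : PowerSeries ℂ) : Prop :=
  ∀ n : ℕ, ∃ a b : ℤ, f.coeff n = (a : ℂ) ∧ g.coeff n = (b : ℂ) ∧ a ≡ b [ZMOD m]

/-- The number `r = (24 * β - 1) / ℓ`. The division is exact when `24 * β ≡ 1 [MOD ℓ]`. -/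
def rNum (ℓ β : ℕ) : ℕ := (24 * β - 1) / ℓ

/-- The number `λ = (ℓ ^ 2 + 24 * β - 1) / (24 * ℓ)`. The division is exact when `ℓ` is a prime
greater than `3` and `24 * β ≡ 1 [MOD ℓ]`. -/
def lamNum (ℓ β : ℕ) : ℕ := (ℓ ^ 2 + 24 * β - 1) / (24 * ℓ)

theorem dvd_sub_one {ℓ β : ℕ} (h1 : 1 ≤ β) (hβ : 24 * β ≡ 1 [MOD ℓ]) : ℓ ∣ 24 * β - 1 :=
  (Nat.modEq_iff_dvd' (by omega)).mp hβ.symm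

theorem rNum_spec {ℓ β : ℕ} (h1 : 1 ≤ β) (hβ : 24 * β ≡ 1 [MOD ℓ]) :
    ℓ * rNum ℓ β = 24 * β - 1 :=
  Nat.mul_div_cancel' (dvd_sub_one h1 hβ)

theorem lamNum_spec {ℓ β : ℕ} (hℓ : ℓ.Prime) (h3 : 3 < ℓ) (h1 : 1 ≤ β)
    (hβ : 24 * β ≡ 1 [MOD ℓ]) : 24 * ℓ * lamNum ℓ β = ℓ ^ 2 + 24 * β - 1 := by
  apply Nat.mul_div_cancel'
  have h2 : ¬ 2 ∣ ℓ := fun h ↦ by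
    have := (Nat.prime_dvd_prime_iff_eq Nat.prime_two hℓ).mp h
    omega
  have h3' : ¬ 3 ∣ ℓ := fun h ↦ by
    have := (Nat.prime_dvd_prime_iff_eq Nat.prime_three hℓ).mp h
    omega
  have hcop : Nat.Coprime 24 ℓ := by
    have a2 : Nat.Coprime 2 ℓ := (Nat.Prime.coprime_iff_not_dvd Nat.prime_two).mpr h2
    have a3 : Nat.Coprime 3 ℓ := (Nat.Prime.coprime_iff_not_dvd Nat.prime_three).mpr h3'
    exact (Nat.Coprime.pow_left 3 a2).mul_left a3
  apply hcop.mul_dvd_of_dvd_of_dvd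
  · have hsq : ℓ ^ 2 % 24 = 1 := by
      have h24 : ℓ % 24 < 24 := Nat.mod_lt _ (by norm_num)
      rw [Nat.pow_mod]
      have e2 : ℓ % 24 % 2 ≠ 0 := by omega
      have e3 : ℓ % 24 % 3 ≠ 0 := by omega
      generalize ℓ % 24 = x at h24 e2 e3
      interval_cases x <;> simp_all
    omega
  · have : ℓ ^ 2 + 24 * β - 1 = ℓ * ℓ + (24 * β - 1) := by
      rw [pow_two]; omega
    rw [this]
    exact Dvd.dvd.add (Dvd.intro _ rfl) (dvd_sub_one h1 hβ)

end ChuaCongruence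

namespace ChuaCongruence

open UpperHalfPlane PowerSeries
open scoped Manifold

local notation "𝕢" => Function.Periodic.qParam

/-! The proof is Serre duality in level one, read modulo `ℓ`. If `f` has weight `12 * m + 2`, then
`f / Δ ^ m` has no constant term (`coeff_mul_eulerInv_pow_eq_zero`). As `Δ = X * euler ^ 24`, that
constant term is the coefficient of index `m` in `f * eulerInv ^ (24 * m)`, so no Laurent series are
needed. Conversely, a series modulo `ℓ` whose product with every integral `a / Δ ^ m` of weight `2 -
w` has zero constant term is the reduction of an integral form of weight `w`
(`Annihilates.exists_red_eq`). Let `S` be the series of `p(F, ℓ n + β)`. To test `S * eulerInv ^ r`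
against `c / Δ ^ m` (`annihilates_section`), use `Y ^ ℓ = Y(q ^ ℓ)`: the pairing becomes the
constant term of `F * c ^ ℓ / Δ ^ (ℓ m + β)`. Multiplying by a power of a form of weight `ℓ - 1`
congruent to `1` brings the weight to `2`, and the residue theorem applies. -/

/-! ### Functions given by a convergent `q`-expansion -/

/-- `f τ = ∑ φ_n q ^ n` on the upper half plane. -/
def HasQExp (f : ℍ → ℂ) (φ : PowerSeries ℂ) : Prop :=
  ∀ τ : ℍ, HasSum (fun n : ℕ ↦ φ.coeff n * 𝕢 1 τ ^ n) (f τ)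

lemma HasQExp.summable_norm {f : ℍ → ℂ} {φ : PowerSeries ℂ} (hf : HasQExp f φ) (τ : ℍ) :
    Summable fun n : ℕ ↦ ‖φ.coeff n * 𝕢 1 τ ^ n‖ :=
  (hf τ).summable.norm

lemma HasQExp.add {f g : ℍ → ℂ} {φ ψ : PowerSeries ℂ} (hf : HasQExp f φ) (hg : HasQExp g ψ) :
    HasQExp (f + g) (φ + ψ) := fun τ ↦ by
  simpa [add_mul] using (hf τ).add (hg τ)

lemma HasQExp.const_mul {f : ℍ → ℂ} {φ : PowerSeries ℂ} (hf : HasQExp f φ) (c : ℂ) :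
    HasQExp (fun τ ↦ c * f τ) (C c * φ) := fun τ ↦ by
  simpa [mul_assoc] using (hf τ).mul_left c

lemma HasQExp.mul {f g : ℍ → ℂ} {φ ψ : PowerSeries ℂ} (hf : HasQExp f φ) (hg : HasQExp g ψ) :
    HasQExp (f * g) (φ * ψ) := fun τ ↦ by
  have e (n : ℕ) : (φ * ψ).coeff n * 𝕢 1 τ ^ n = ∑ kl ∈ Finset.HasAntidiagonal.antidiagonal n,
      (φ.coeff kl.1 * 𝕢 1 τ ^ kl.1) * (ψ.coeff kl.2 * 𝕢 1 τ ^ kl.2) := by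
    rw [coeff_mul, Finset.sum_mul]
    refine Finset.sum_congr rfl fun kl hkl ↦ ?_
    rw [← Finset.HasAntidiagonal.mem_antidiagonal.mp hkl, pow_add]
    ring
  simp only [e, Pi.mul_apply, ← (hf τ).tsum_eq, ← (hg τ).tsum_eq]
  rw [tsum_mul_tsum_eq_tsum_sum_antidiagonal_of_summable_norm (hf.summable_norm τ)
    (hg.summable_norm τ)]
  exact (summable_norm_sum_mul_antidiagonal_of_summable_norm (hf.summable_norm τ)
    (hg.summable_norm τ)).of_norm.hasSum

lemma HasQExp.one : HasQExp 1 1 := fun τ ↦ by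
  convert! hasSum_ite_eq (0 : ℕ) (1 : ℂ) using 2 with n
  by_cases hn : n = 0 <;> simp [coeff_one, hn]

lemma HasQExp.pow {f : ℍ → ℂ} {φ : PowerSeries ℂ} (hf : HasQExp f φ) (n : ℕ) :
    HasQExp (f ^ n) (φ ^ n) := by
  induction n with
  | zero => simpa using HasQExp.one
  | succ n ih => simpa [pow_succ] using ih.mul hf

lemma HasQExp.congr {f g : ℍ → ℂ} {φ : PowerSeries ℂ} (hf : HasQExp f φ) (h : ∀ τ, f τ = g τ) :
    HasQExp g φ := funext h ▸ hf

lemma HasQExp.comp_ofComplex {f : ℍ → ℂ} {φ : PowerSeries ℂ} (hf : HasQExp f φ) {z : ℂ}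
    (hz : 0 < z.im) : (f ∘ ofComplex) z = ∑' n : ℕ, φ.coeff n * 𝕢 1 z ^ n := by
  rw [Function.comp_apply, ofComplex_apply_of_im_pos hz]
  exact (hf ⟨z, hz⟩).tsum_eq.symm

/-- The Weierstrass bound on a half plane, used for termwise differentiation. -/
lemma norm_qParam_pow_le {y : ℝ} {w : ℂ} (hw : y < w.im) (c : ℂ) (n : ℕ) :
    ‖c * 𝕢 1 w ^ n‖ ≤ ‖c * 𝕢 1 (y * Complex.I) ^ n‖ := by
  simp only [norm_mul, norm_pow, Function.Periodic.norm_qParam]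
  gcongr ‖c‖ * Real.exp ?_ ^ n
  simpa using mul_le_mul_of_nonneg_left hw.le Real.two_pi_pos.le

lemma HasQExp.summable_norm_mul_I {f : ℍ → ℂ} {φ : PowerSeries ℂ} (hf : HasQExp f φ) {y : ℝ}
    (hy : 0 < y) : Summable fun n : ℕ ↦ ‖φ.coeff n * 𝕢 1 (y * Complex.I) ^ n‖ :=
  hf.summable_norm ⟨y * Complex.I, by simpa using hy⟩

lemma isOpen_lt_im (y : ℝ) : IsOpen {w : ℂ | y < w.im} :=
  isOpen_lt continuous_const Complex.continuous_im

lemma differentiable_coeff_mul_qParam_pow (c : ℂ) (n : ℕ) :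
    Differentiable ℂ fun z : ℂ ↦ c * 𝕢 1 z ^ n := by
  fun_prop

lemma HasQExp.mdiff {f : ℍ → ℂ} {φ : PowerSeries ℂ} (hf : HasQExp f φ) : MDiff f := by
  intro τ
  rw [UpperHalfPlane.mdifferentiableAt_iff]
  have hτ : (τ : ℂ) ∈ {w : ℂ | τ.im / 2 < w.im} := half_lt_self τ.im_pos
  have hd := Complex.differentiableOn_tsum_of_summable_norm
    (hf.summable_norm_mul_I (half_pos τ.im_pos))
    (fun n ↦ (differentiable_coeff_mul_qParam_pow (φ.coeff n) n).differentiableOn)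
    (isOpen_lt_im (τ.im / 2)) (fun n w hw ↦ norm_qParam_pow_le hw _ n)
  refine (hd.congr fun w hw ↦ ?_).differentiableAt ((isOpen_lt_im _).mem_nhds hτ)
  exact hf.comp_ofComplex ((half_pos τ.im_pos).trans hw)

lemma coeff_X_mul_derivative (φ : ℂ⟦X⟧) (n : ℕ) :
    (X * derivative ℂ φ).coeff n = n * φ.coeff n := by
  rcases n with _ | n
  · simp
  · rw [coeff_succ_X_mul, coeff_derivative]
    push_cast
    ring

lemma HasQExp.deriv {f : ℍ → ℂ} {φ : PowerSeries ℂ} (hf : HasQExp f φ) :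
    HasQExp (Derivative.normalizedDerivOfComplex f) (X * derivative ℂ φ) := fun τ ↦ by
  have hτ : (τ : ℂ) ∈ {w : ℂ | τ.im / 2 < w.im} := half_lt_self τ.im_pos
  have hd := Complex.hasSum_deriv_of_summable_norm
    (hf.summable_norm_mul_I (half_pos τ.im_pos))
    (fun n ↦ (differentiable_coeff_mul_qParam_pow (φ.coeff n) n).differentiableOn)
    (isOpen_lt_im (τ.im / 2)) (fun n w hw ↦ norm_qParam_pow_le hw _ n) hτ
  have he : _root_.deriv (fun w : ℂ ↦ ∑' n : ℕ, φ.coeff n * 𝕢 1 w ^ n) τ =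
      _root_.deriv (f ∘ ofComplex) τ := by
    refine Filter.EventuallyEq.deriv_eq ?_
    filter_upwards [(isOpen_lt_im _).mem_nhds hτ] with w hw
    exact (hf.comp_ofComplex ((half_pos τ.im_pos).trans hw)).symm
  rw [he] at hd
  have hq (n : ℕ) : _root_.deriv (fun z : ℂ ↦ φ.coeff n * 𝕢 1 z ^ n) τ =
      2 * Real.pi * Complex.I * (n * φ.coeff n * 𝕢 1 τ ^ n) := by
    have h1 : HasDerivAt (fun z : ℂ ↦ 𝕢 1 z) (2 * Real.pi * Complex.I * 𝕢 1 τ) τ := by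
      have := ((hasDerivAt_id (τ : ℂ)).const_mul (2 * Real.pi * Complex.I)).cexp
      convert! this using 1
      · ext z
        simp [Function.Periodic.qParam]
      · simp [Function.Periodic.qParam, mul_comm]
    rw [HasDerivAt.deriv (f := fun z : ℂ ↦ φ.coeff n * 𝕢 1 z ^ n) ((h1.pow n).const_mul _)]
    rcases n with _ | n
    · simp
    · simp [pow_succ]
      ring
  simp only [hq] at hd
  simp only [coeff_X_mul_derivative, Derivative.normalizedDerivOfComplex]
  have := hd.mul_left (2 * Real.pi * Complex.I)⁻¹
  simpa only [inv_mul_cancel_left₀ Complex.two_pi_I_ne_zero] using this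

lemma HasQExp.isBoundedAtImInfty {f : ℍ → ℂ} {φ : PowerSeries ℂ} (hf : HasQExp f φ) :
    IsBoundedAtImInfty f :=
  isBoundedAtImInfty_of_hasSum_qExpansion one_pos hf

/-- Uniqueness of the expansion: this turns identities of functions into identities of formal
series. -/
lemma HasQExp.qExpansion_eq {f : ℍ → ℂ} {φ : PowerSeries ℂ} (hf : HasQExp f φ) :
    qExpansion 1 f = φ := by
  have hper : Function.Periodic (f ∘ ofComplex) (1 : ℝ) := fun z ↦ by
    by_cases hz : 0 < z.im
    · rw [hf.comp_ofComplex hz, hf.comp_ofComplex (by simpa using hz)]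
      congr! 3
      simp [Function.Periodic.qParam, mul_add, Complex.exp_add]
    · simp only [Function.comp_apply]
      rw [ofComplex_apply_of_im_nonpos (not_lt.mp hz),
        ofComplex_apply_of_im_nonpos (by simpa using hz)]
  have han := analyticAt_cuspFunction_zero one_pos hper hf.mdiff hf.isBoundedAtImInfty
  have h := (hasFPowerSeriesOnBall_cuspFunction one_pos han hf).hasFPowerSeriesAt
  ext n
  simpa [qExpansion_coeff, div_eq_inv_mul] using
    congr_arg (FormalMultilinearSeries.coeff · n)
      (han.hasFPowerSeriesAt.eq_formalMultilinearSeries h)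

lemma hasQExp_modularForm {k : ℤ} (f : ModularForm 𝒮ℒ k) : HasQExp f (qExpansion 1 f) := fun τ ↦
  ModularForm.hasSum_qExpansion f one_pos one_mem_strictPeriods_SL τ

/-- A holomorphic function of `q` on the unit disc has a `q`-expansion, its Taylor series. -/
lemma hasQExp_of_differentiableOn {Φ : ℂ → ℂ} (hΦ : DifferentiableOn ℂ Φ (Metric.ball 0 1)) :
    HasQExp (fun τ ↦ Φ (𝕢 1 τ))
      (PowerSeries.mk fun n ↦ (n.factorial : ℂ)⁻¹ * iteratedDeriv n Φ 0) := fun τ ↦ by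
  have hq : 𝕢 1 (τ : ℂ) ∈ Metric.ball (0 : ℂ) 1 := by
    simpa using UpperHalfPlane.norm_qParam_lt_one 1 τ
  convert! Complex.hasSum_taylorSeries_on_ball hΦ hq using 2 with n
  simp [mul_comm, mul_assoc]

/-- Replacing `τ` by `24 * τ` replaces `q` by `q ^ 24`. -/
lemma HasQExp.comp_mul24 {f : ℍ → ℂ} {φ : PowerSeries ℂ} (hf : HasQExp f φ) :
    HasQExp (fun τ ↦ f (mul24 τ)) (expand 24 (by norm_num) φ) := fun τ ↦ by
  have hq : 𝕢 1 (mul24 τ : ℂ) = 𝕢 1 τ ^ 24 := by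
    simp only [Function.Periodic.qParam, mul24, ← Complex.exp_nat_mul]
    congr 1
    push_cast
    ring
  have h := hf (mul24 τ)
  have hinj : Function.Injective fun n : ℕ ↦ 24 * n := fun a b hab ↦ by simpa using hab
  refine (hinj.hasSum_iff fun n hn ↦ ?_).mp ?_
  · rw [coeff_expand_of_not_dvd _ _ _ fun ⟨m, hm⟩ ↦ hn ⟨m, hm.symm⟩, zero_mul]
  · convert! h using 2 with n
    simp only [Function.comp_apply]
    rw [coeff_expand_mul, hq, pow_mul]

/-! ### The Euler product and the discriminant -/

/-- The Euler product `∏ (1 - q ^ (m + 1))`. -/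
noncomputable def eulerFun (q : ℂ) : ℂ := ∏' m : ℕ, (1 - q ^ (m + 1))

/-- Base change of integral power series to `ℂ`. -/
noncomputable abbrev toC : ℤ⟦X⟧ →+* ℂ⟦X⟧ := PowerSeries.map (Int.castRingHom ℂ)

lemma iteratedDeriv_eval_zero (p : Polynomial ℤ) (n : ℕ) :
    (n.factorial : ℂ)⁻¹ * iteratedDeriv n (fun z : ℂ ↦ Polynomial.aeval z p) 0 = p.coeff n := by
  have h : iteratedDeriv n (fun z : ℂ ↦ Polynomial.aeval z p) =
      fun z ↦ Polynomial.aeval z (Polynomial.derivative^[n] p) := by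
    induction n with
    | zero => simp
    | succ n ih =>
      ext z
      rw [iteratedDeriv_succ, ih, Function.iterate_succ_apply', Polynomial.deriv_aeval]
  have hc : (Polynomial.derivative^[n] p).coeff 0 = n.factorial * p.coeff n := by
    simp [Polynomial.coeff_iterate_derivative, Nat.descFactorial_self]
  simp only [h, ← Polynomial.coeff_zero_eq_aeval_zero', hc]
  simp [Nat.factorial_ne_zero]

lemma tendstoLocallyUniformlyOn_iteratedDeriv {ι : Type*} {l : Filter ι} {F : ι → ℂ → ℂ}
    {f : ℂ → ℂ} {U : Set ℂ} (hU : IsOpen U) (hF : ∀ i, Differentiable ℂ (F i))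
    (h : TendstoLocallyUniformlyOn F f l U) (n : ℕ) :
    TendstoLocallyUniformlyOn (fun i ↦ iteratedDeriv n (F i)) (iteratedDeriv n f) l U := by
  induction n with
  | zero => simpa using h
  | succ n ih =>
    simp only [iteratedDeriv_succ]
    exact ih.deriv (.of_forall fun i ↦
      ((hF i).contDiff.differentiable_iteratedDeriv n
        (WithTop.coe_lt_coe.mpr (ENat.natCast_lt_top n))).differentiableOn)
      hU

/-- The finite products are integer polynomials, their Taylor coefficients converge by local
uniformity, and `ℤ` is closed in `ℂ`. -/
lemma exists_coeff_eulerFun (n : ℕ) :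
    ∃ a : ℤ, (n.factorial : ℂ)⁻¹ * iteratedDeriv n eulerFun 0 = a := by
  have h := ModularForm.multipliableLocallyUniformlyOn_one_sub_pow.hasProdLocallyUniformlyOn
  have h1 := tendstoLocallyUniformlyOn_iteratedDeriv Metric.isOpen_ball
    (fun s ↦ by fun_prop) h n
  have h2 := (h1.tendsto_at (Metric.mem_ball_self one_pos)).const_mul (n.factorial : ℂ)⁻¹
  obtain ⟨a, ha⟩ := Complex.isClosed_range_intCast.mem_of_tendsto h2 <| .of_forall fun s ↦ by
    refine ⟨(∏ m ∈ s, (1 - Polynomial.X ^ (m + 1)) : Polynomial ℤ).coeff n, ?_⟩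
    rw [← iteratedDeriv_eval_zero]
    simp
  exact ⟨a, ha.symm⟩

/-- The Euler product as an integral power series. -/
noncomputable def euler : ℤ⟦X⟧ := PowerSeries.mk fun n ↦ (exists_coeff_eulerFun n).choose

lemma toC_euler :
    toC euler = PowerSeries.mk fun n ↦ (n.factorial : ℂ)⁻¹ * iteratedDeriv n eulerFun 0 := by
  ext n
  simpa [euler] using (exists_coeff_eulerFun n).choose_spec.symm

lemma differentiableOn_eulerFun : DifferentiableOn ℂ eulerFun (Metric.ball 0 1) :=
  ModularForm.differentiableOn_tprod_one_sub_pow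

lemma hasQExp_euler : HasQExp (fun τ ↦ eulerFun (𝕢 1 τ)) (toC euler) :=
  toC_euler ▸ hasQExp_of_differentiableOn differentiableOn_eulerFun

lemma eulerFun_zero : eulerFun 0 = 1 := by simp [eulerFun]

lemma constantCoeff_euler : constantCoeff euler = 1 := by
  have := congr_arg (coeff 0) toC_euler
  rw [coeff_map, coeff_mk] at this
  simpa [eulerFun_zero] using this

lemma eulerFun_ne_zero {q : ℂ} (hq : q ∈ Metric.ball (0 : ℂ) 1) : eulerFun q ≠ 0 := by
  rcases eq_or_ne q 0 with rfl | h0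
  · simp [eulerFun_zero]
  · have := ModularForm.eta_tprod_ne_zero (Function.Periodic.im_invQParam_pos_of_norm_lt_one
      one_pos (by simpa using hq) h0)
    simpa [eulerFun, ModularForm.eta_q, Function.Periodic.qParam_right_inv one_ne_zero h0] using this

/-- The inverse of the Euler product, the generating series of the partition numbers. -/
noncomputable def eulerInv : ℤ⟦X⟧ := invOfUnit euler 1

lemma euler_mul_eulerInv : euler * eulerInv = 1 :=
  mul_invOfUnit _ _ (by simp [constantCoeff_euler])

lemma constantCoeff_eulerInv : constantCoeff eulerInv = 1 := by
  simp [eulerInv]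

lemma hasQExp_eulerInv : HasQExp (fun τ ↦ (eulerFun (𝕢 1 τ))⁻¹) (toC eulerInv) := by
  have h := hasQExp_of_differentiableOn
    (differentiableOn_eulerFun.fun_inv fun q hq ↦ eulerFun_ne_zero hq)
  have h1 := (hasQExp_euler.mul h).congr (g := 1) fun τ ↦
    mul_inv_cancel₀ (eulerFun_ne_zero (by simpa using UpperHalfPlane.norm_qParam_lt_one 1 τ))
  have h2 := h1.qExpansion_eq.symm.trans HasQExp.one.qExpansion_eq
  have h3 : toC euler * toC eulerInv = 1 := by rw [← map_mul, euler_mul_eulerInv, map_one]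
  -- The Taylor series of the analytic inverse and the formal inverse are both inverse to `toC
  -- euler`, hence equal.
  rwa [← left_inv_eq_right_inv ((mul_comm _ _).trans h3) h2] at h

lemma hasQExp_qParam : HasQExp (fun τ ↦ 𝕢 1 τ) X := fun τ ↦ by
  convert! hasSum_ite_eq (1 : ℕ) (𝕢 1 τ) using 2 with n
  by_cases hn : n = 1 <;> simp [coeff_X, hn]

lemma hasQExp_discriminant : HasQExp CuspForm.discriminant (toC (X * euler ^ 24)) := by
  have := hasQExp_qParam.mul (hasQExp_euler.pow 24)
  rw [map_mul, map_pow, map_X]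
  refine this.congr fun τ ↦ ?_
  simp only [CuspForm.coe_discriminant, ModularForm.discriminant, ModularForm.eta, mul_pow,
    Pi.mul_apply, Pi.pow_apply, eulerFun, ModularForm.eta_q]
  congr 1
  simp only [Function.Periodic.qParam, ← Complex.exp_nat_mul]
  congr 1
  push_cast
  ring

lemma hasQExp_eta_mul24 :
    HasQExp (fun τ ↦ ModularForm.eta (mul24 τ)) (X * expand 24 (by norm_num) (toC euler)) := by
  refine (hasQExp_qParam.mul hasQExp_euler.comp_mul24).congr fun τ ↦ ?_
  simp only [ModularForm.eta, Pi.mul_apply, eulerFun, ModularForm.eta_q]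
  congr 1
  simp only [Function.Periodic.qParam, mul24]
  congr 1
  push_cast
  ring

/-! ### `q`-expansions of level-one modular forms -/

/-- `φ` is the `q`-expansion of a level-one modular form of weight `k`. -/
def IsModularSeries (k : ℤ) (φ : ℂ⟦X⟧) : Prop :=
  ∃ f : ModularForm 𝒮ℒ k, qExpansion 1 f = φ

lemma IsModularSeries.mul {k l : ℤ} {φ ψ : ℂ⟦X⟧} (hφ : IsModularSeries k φ)
    (hψ : IsModularSeries l ψ) : IsModularSeries (k + l) (φ * ψ) := by
  obtain ⟨f, rfl⟩ := hφ
  obtain ⟨g, rfl⟩ := hψ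
  exact ⟨f.mul g, ModularForm.qExpansion_mul one_pos one_mem_strictPeriods_SL f g⟩

lemma IsModularSeries.add {k : ℤ} {φ ψ : ℂ⟦X⟧} (hφ : IsModularSeries k φ)
    (hψ : IsModularSeries k ψ) : IsModularSeries k (φ + ψ) := by
  obtain ⟨f, rfl⟩ := hφ
  obtain ⟨g, rfl⟩ := hψ
  exact ⟨f + g, ModularForm.qExpansion_add one_pos one_mem_strictPeriods_SL f g⟩

lemma IsModularSeries.zero (k : ℤ) : IsModularSeries k 0 :=
  ⟨0, qExpansion_zero 1⟩

lemma IsModularSeries.one : IsModularSeries 0 1 :=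
  ⟨1, ModularForm.qExpansion_one⟩

lemma IsModularSeries.C_mul {k : ℤ} {φ : ℂ⟦X⟧} (hφ : IsModularSeries k φ) (c : ℂ) :
    IsModularSeries k (C c * φ) := by
  obtain ⟨f, rfl⟩ := hφ
  exact ⟨c • f, by
    rw [← smul_eq_C_mul]
    exact ModularForm.qExpansion_smul one_pos one_mem_strictPeriods_SL c f⟩

lemma IsModularSeries.cast {k l : ℤ} {φ : ℂ⟦X⟧} (hφ : IsModularSeries k φ) (h : k = l) :
    IsModularSeries l φ := h ▸ hφ

lemma IsModularSeries.pow {k : ℤ} {φ : ℂ⟦X⟧} (hφ : IsModularSeries k φ) (n : ℕ) :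
    IsModularSeries (n * k) (φ ^ n) := by
  induction n with
  | zero => simpa using IsModularSeries.one
  | succ n ih => exact pow_succ φ n ▸ (ih.mul hφ).cast (by push_cast; ring)

lemma isModularSeries_discriminant : IsModularSeries 12 (toC (X * euler ^ 24)) :=
  ⟨(CuspForm.discriminant : ModularForm 𝒮ℒ 12), hasQExp_discriminant.qExpansion_eq⟩

/-! ### The Serre derivative and the residue theorem in weight two -/

/-- The `q`-expansion of the Eisenstein series `E2`. -/
noncomputable def e2Series : ℂ⟦X⟧ := qExpansion 1 EisensteinSeries.E2

lemma hasQExp_E2_sigma : HasQExp EisensteinSeries.E2 (PowerSeries.mk fun m ↦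
    (if m = 0 then 1 else -24 * (ArithmeticFunction.sigma 1 m : ℂ))) := fun τ ↦ by
  simpa only [coeff_mk, Function.Periodic.qParam, Complex.ofReal_one, div_one, smul_eq_mul] using
    EisensteinSeries.hasSum_qExpansion_E2 (z := τ)

lemma hasQExp_E2 : HasQExp EisensteinSeries.E2 e2Series := by
  rw [e2Series, hasQExp_E2_sigma.qExpansion_eq]
  exact hasQExp_E2_sigma

lemma constantCoeff_e2Series : constantCoeff e2Series = 1 := by
  rw [e2Series, hasQExp_E2_sigma.qExpansion_eq, ← coeff_zero_eq_constantCoeff_apply, coeff_mk,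
    if_pos rfl]

lemma normalizedDeriv_discriminant (τ : ℍ) :
    Derivative.normalizedDerivOfComplex CuspForm.discriminant τ =
      EisensteinSeries.E2 τ * CuspForm.discriminant τ := by
  have hd := ModularForm.differentiableAt_eta_of_mem_upperHalfPlaneSet τ.2
  have h := ModularForm.logDeriv_eta_eq_E2 τ
  have h0 := ModularForm.eta_ne_zero τ.2
  rw [logDeriv_apply, div_eq_iff h0] at h
  have he : deriv (⇑CuspForm.discriminant ∘ ofComplex) τ =
      deriv (fun z ↦ ModularForm.eta z ^ 24) τ := by
    refine Filter.EventuallyEq.deriv_eq ?_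
    filter_upwards [isOpen_upperHalfPlaneSet.mem_nhds τ.2] with w hw
    simp [CuspForm.coe_discriminant, ModularForm.discriminant, ofComplex_apply_of_im_pos hw]
  rw [Derivative.normalizedDerivOfComplex, he,
    HasDerivAt.deriv (f := fun z ↦ ModularForm.eta z ^ 24) (hd.hasDerivAt.pow 24), h]
  have := Complex.two_pi_I_ne_zero
  simp only [CuspForm.coe_discriminant, ModularForm.discriminant]
  have hpi : (Real.pi : ℂ) ≠ 0 := by simp [Real.pi_ne_zero]
  field_simp
  push_cast
  ring

lemma X_mul_derivative_discriminant :
    X * derivative ℂ (toC (X * euler ^ 24)) = e2Series * toC (X * euler ^ 24) := by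
  have h1 := hasQExp_discriminant.deriv.congr normalizedDeriv_discriminant
  exact h1.qExpansion_eq.symm.trans (hasQExp_E2.mul hasQExp_discriminant).qExpansion_eq

lemma toC_euler_mul_eulerInv : toC euler * toC eulerInv = 1 := by
  rw [← map_mul, euler_mul_eulerInv, map_one]

/-- This is `q dΔ/dq = E2 * Δ` rewritten for `eulerInv`, after cancelling `X * euler ^ 23`. -/
lemma X_mul_derivative_eulerInv :
    24 * (X * derivative ℂ (toC eulerInv)) = (1 - e2Series) * toC eulerInv := by
  have h := X_mul_derivative_discriminant
  have hi := toC_euler_mul_eulerInv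
  have hd := congr_arg (derivative ℂ) hi
  simp only [map_mul, map_pow, map_X, Derivation.leibniz, Derivation.leibniz_pow, smul_eq_mul,
    nsmul_eq_mul, derivative_X, derivative_one] at h hd
  have hX : (X : ℂ⟦X⟧) ≠ 0 := X_ne_zero
  generalize toC euler = P at *
  generalize toC eulerInv = I at *
  have h' : P + 24 * (X * derivative ℂ P) = e2Series * P := by
    have hP : P ^ 23 ≠ 0 := pow_ne_zero _ fun h0 ↦ by simp [h0] at hi
    refine mul_left_cancel₀ (mul_ne_zero hX hP) ?_
    push_cast at h
    linear_combination h
  linear_combination (24 * X * I) * hd - 24 * X * derivative ℂ I * hi - I ^ 2 * h' +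
    (I - e2Series * I) * hi

lemma X_mul_derivative_mul_eulerInv_pow (φ : ℂ⟦X⟧) (n : ℕ) :
    X * derivative ℂ (φ * toC eulerInv ^ (24 * n)) =
      (X * derivative ℂ φ - (n : ℂ⟦X⟧) * e2Series * φ) * toC eulerInv ^ (24 * n) +
        (n : ℂ⟦X⟧) * (φ * toC eulerInv ^ (24 * n)) := by
  rcases n with _ | n
  · simp
  have h := X_mul_derivative_eulerInv
  simp only [Derivation.leibniz, Derivation.leibniz_pow, smul_eq_mul, nsmul_eq_mul]
  generalize toC eulerInv = I at *
  have e : 24 * (n + 1) - 1 = 24 * n + 23 := by omega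
  rw [e, show 24 * (n + 1) = 24 * n + 23 + 1 by ring, pow_succ]
  push_cast
  linear_combination (φ * ((n : ℂ⟦X⟧) + 1) * I ^ (24 * n + 23)) * h

/-- In weight `12 * n`, the Serre derivative of `φ` divided by `Δ ^ n` is `q d/dq` of `φ / Δ ^ n`,
which has no constant term. -/
lemma coeff_serre_mul_eulerInv_pow (φ : ℂ⟦X⟧) (n : ℕ) :
    ((X * derivative ℂ φ - (n : ℂ⟦X⟧) * e2Series * φ) * toC eulerInv ^ (24 * n)).coeff n = 0 := by
  have h := congr_arg (coeff n) (X_mul_derivative_mul_eulerInv_pow φ n)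
  rw [coeff_X_mul_derivative, map_add, ← nsmul_eq_mul (n := n) (a := φ * _), map_nsmul,
    nsmul_eq_mul] at h
  simpa using h

/-- The Serre derivative of a level-one modular form, as a modular form. -/
noncomputable def serreDerivForm {k : ℤ} (f : ModularForm 𝒮ℒ k) : ModularForm 𝒮ℒ (k + 2) where
  toFun := Derivative.serreDerivative k f
  slash_action_eq' := by
    rintro _ ⟨γ, rfl⟩
    exact Derivative.serreDerivative_slash_invariant (ModularFormClass.holo f)
      (SlashInvariantFormClass.slash_action_eq f _ ⟨γ, rfl⟩)
  holo' := Derivative.serreDerivative_mdifferentiable _ (ModularFormClass.holo f)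
  bdd_at_cusps' {c} hc := by
    rw [Subgroup.IsArithmetic.isCusp_iff_isCusp_SL2Z] at hc
    rw [OnePoint.isBoundedAt_iff_forall_SL2Z hc]
    intro γ _
    have : Derivative.serreDerivative k f ∣[k + 2] γ = Derivative.serreDerivative k f :=
      Derivative.serreDerivative_slash_invariant (ModularFormClass.holo f)
        (SlashInvariantFormClass.slash_action_eq f _ ⟨γ, rfl⟩)
    -- By invariance every cusp reduces to `i∞`, where the `q`-expansion gives boundedness.
    rw [this]
    have h1 := (hasQExp_modularForm f).deriv.isBoundedAtImInfty
    have h2 := ((hasQExp_E2.mul (hasQExp_modularForm f)).const_mul (-(k * 12⁻¹))).isBoundedAtImInfty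
    refine (h1.add h2).congr_left fun τ ↦ ?_
    simp [Derivative.serreDerivative]
    ring

lemma IsModularSeries.serre {n : ℕ} {φ : ℂ⟦X⟧} (hφ : IsModularSeries (12 * n) φ) :
    IsModularSeries (12 * n + 2) (X * derivative ℂ φ - (n : ℂ⟦X⟧) * e2Series * φ) := by
  obtain ⟨f, rfl⟩ := hφ
  refine ⟨serreDerivForm f, HasQExp.qExpansion_eq ?_⟩
  have h1 := (hasQExp_modularForm f).deriv
  have h2 := (hasQExp_E2.mul (hasQExp_modularForm f)).const_mul (-(n : ℂ))
  convert! (h1.add h2).congr (g := serreDerivForm f) fun τ ↦ ?_ using 1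
  · simp
    ring
  · change _ = Derivative.serreDerivative _ f τ
    simp [Derivative.serreDerivative]
    ring

lemma IsModularSeries.eq_zero_of_weight_two {φ : ℂ⟦X⟧} (hφ : IsModularSeries 2 φ) : φ = 0 := by
  obtain ⟨f, rfl⟩ := hφ
  rw [rank_zero_iff_forall_zero.mp ModularForm.levelOne_weight_two_rank_zero f]
  exact qExpansion_zero 1

lemma IsModularSeries.exists_eq_discriminant_mul {k : ℤ} {φ : ℂ⟦X⟧}
    (hφ : IsModularSeries (k + 12) φ) (h0 : constantCoeff φ = 0) :
    ∃ ψ, IsModularSeries k ψ ∧ φ = toC (X * euler ^ 24) * ψ := by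
  obtain ⟨f, rfl⟩ := hφ
  have h := ModularForm.qExpansion_eq_qExpansion_discriminant_mul f (by simpa using h0)
  rw [← CuspForm.coe_discriminant, hasQExp_discriminant.qExpansion_eq] at h
  exact ⟨_, IsModularSeries.cast ⟨_, rfl⟩ (by ring), h⟩

lemma exists_isModularSeries_twelve_mul (n : ℕ) :
    ∃ φ, IsModularSeries (12 * n) φ ∧ constantCoeff φ = 1 := by
  refine ⟨_, (IsModularSeries.pow ⟨ModularForm.E (k := 4) (by norm_num), rfl⟩ (3 * n)).cast
    (by push_cast; ring), ?_⟩
  have := EisensteinSeries.E_qExpansion_coeff_zero (k := 4) (by norm_num) ⟨2, rfl⟩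
  rw [coeff_zero_eq_constantCoeff] at this
  rw [map_pow, this, one_pow]

/-- The residue theorem: if `f` has weight `12 * m + 2` then `f / Δ ^ m` has no constant term. -/
theorem coeff_mul_eulerInv_pow_eq_zero (m : ℕ) {φ : ℂ⟦X⟧} (hφ : IsModularSeries (12 * m + 2) φ) :
    (φ * toC eulerInv ^ (24 * m)).coeff m = 0 := by
  induction m generalizing φ with
  | zero => simp [IsModularSeries.eq_zero_of_weight_two (hφ.cast (by simp))]
  | succ m ih =>
    obtain ⟨h, hh, h0⟩ := exists_isModularSeries_twelve_mul (m + 1)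
    have hs := hh.serre
    have hs0 := coeff_serre_mul_eulerInv_pow h (m + 1)
    set s := X * derivative ℂ h - ((m + 1 : ℕ) : ℂ⟦X⟧) * e2Series * h with hsdef
    have hsc : constantCoeff s = -(m + 1 : ℂ) := by
      simp [hsdef, h0, constantCoeff_e2Series]
    have hm : (m + 1 : ℂ) ≠ 0 := by exact_mod_cast m.succ_ne_zero
    -- `s` has constant term `-(m + 1)`, so `φ + c * s` is a cusp form and equals `Δ * ψ`. Adding `c
    -- * s` leaves the residue unchanged, and `ψ` falls under the induction hypothesis.
    set c := constantCoeff φ / (m + 1 : ℂ) with hc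
    obtain ⟨ψ, hψ, e⟩ := ((hφ.add (hs.C_mul c)).cast
      (l := 12 * (m : ℤ) + 2 + 12) (by push_cast; ring)).exists_eq_discriminant_mul (by
        rw [map_add, map_mul, hsc, constantCoeff_C, hc]
        field_simp
        ring)
    have e1 : φ * toC eulerInv ^ (24 * (m + 1)) =
        X * (ψ * toC eulerInv ^ (24 * m)) - C c * (s * toC eulerInv ^ (24 * (m + 1))) := by
      have hi : toC euler ^ 24 * toC eulerInv ^ 24 = 1 := by
        rw [← mul_pow, toC_euler_mul_eulerInv, one_pow]
      rw [map_mul, map_X, map_pow] at e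
      rw [mul_add, mul_one, pow_add]
      linear_combination (toC eulerInv ^ (24 * m) * toC eulerInv ^ 24) * e +
        (X * ψ * toC eulerInv ^ (24 * m)) * hi
    rw [e1, map_sub, coeff_succ_X_mul, ih hψ, coeff_C_mul, hs0]
    simp

/-! ### Integral forms with constant term one -/

lemma bernoulli_four : bernoulli 4 = -1 / 30 := by decide +kernel

lemma bernoulli_six : bernoulli 6 = 1 / 42 := by decide +kernel

lemma exists_eisenstein_four :
    ∃ a : ℤ⟦X⟧, IsModularSeries 4 (toC a) ∧ constantCoeff a = 1 := by
  refine ⟨PowerSeries.mk fun m ↦ if m = 0 then 1 else 240 * ArithmeticFunction.sigma 3 m,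
    ⟨ModularForm.E (k := 4) (by norm_num), ?_⟩, by
      rw [← coeff_zero_eq_constantCoeff_apply, coeff_mk, if_pos rfl]⟩
  ext m
  rw [EisensteinSeries.E_qExpansion_coeff _ ⟨2, rfl⟩, coeff_map, coeff_mk, bernoulli_four]
  split_ifs <;> norm_num

lemma exists_eisenstein_six :
    ∃ a : ℤ⟦X⟧, IsModularSeries 6 (toC a) ∧ constantCoeff a = 1 := by
  refine ⟨PowerSeries.mk fun m ↦ if m = 0 then 1 else -504 * ArithmeticFunction.sigma 5 m,
    ⟨ModularForm.E (k := 6) (by norm_num), ?_⟩, by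
      rw [← coeff_zero_eq_constantCoeff_apply, coeff_mk, if_pos rfl]⟩
  ext m
  rw [EisensteinSeries.E_qExpansion_coeff _ ⟨3, rfl⟩, coeff_map, coeff_mk, bernoulli_six]
  split_ifs <;> norm_num

lemma exists_constantCoeff_eq_one {v : ℤ} (hv : Even v) (h0 : 0 ≤ v) (h2 : v ≠ 2) :
    ∃ a : ℤ⟦X⟧, IsModularSeries v (toC a) ∧ constantCoeff a = 1 := by
  obtain ⟨i, j, hij⟩ : ∃ i j : ℕ, v = i * 4 + j * 6 := by
    obtain ⟨u, rfl⟩ := hv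
    rcases Int.even_or_odd' u with ⟨c, rfl | rfl⟩
    · exact ⟨c.toNat, 0, by omega⟩
    · exact ⟨(c - 1).toNat, 1, by omega⟩
  obtain ⟨a, ha, ha0⟩ := exists_eisenstein_four
  obtain ⟨b, hb, hb0⟩ := exists_eisenstein_six
  refine ⟨a ^ i * b ^ j, ?_, by simp [ha0, hb0]⟩
  rw [map_mul, map_pow, map_pow]
  exact ((ha.pow i).mul (hb.pow j)).cast hij.symm

/-- The case `p - 1 = 2 * k` of the von Staudt–Clausen theorem, solved for the Bernoulli number. -/
lemma exists_bernoulli_mul_eq {p : ℕ} (hp : p.Prime) (h2 : 2 < p) :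
    ∃ M D : ℤ, ¬ (p : ℤ) ∣ M ∧ bernoulli (p - 1) * (p * D) = M := by
  have hpo := hp.eq_two_or_odd'.resolve_left h2.ne'
  obtain ⟨k, hk⟩ := hpo
  obtain ⟨n, hn⟩ := Bernoulli.vonStaudt_clausen k
  have hk' : 2 * k = p - 1 := by omega
  set S := (Finset.range (2 * k + 2)).filter fun q ↦ q.Prime ∧ (q - 1) ∣ 2 * k with hS
  have hpS : p ∈ S := by
    simp only [hS, Finset.mem_filter, Finset.mem_range]
    exact ⟨by omega, hp, by rw [hk']⟩
  rw [← Finset.add_sum_erase S _ hpS, hk'] at hn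
  set r := ∑ q ∈ S.erase p, (1 : ℚ) / q with hr
  have hcop : r.den.Coprime p := by
    refine Nat.Coprime.of_dvd_left (Finset.Rat.den_sum_dvd_prod_den _ _) (Nat.Coprime.prod_left ?_)
    intro q hq
    have hq' := Finset.mem_erase.mp hq
    have hqp : q.Prime := (Finset.mem_filter.mp hq'.2).2.1
    rw [show ((1 : ℚ) / q).den = q by simp [hqp.ne_zero]]
    exact (Nat.coprime_primes hqp hp).mpr hq'.1
  -- Von Staudt–Clausen reads `B + 1/p + r = n` with the denominator of `r` prime to `p`. Clearing
  -- denominators gives `M ≡ -r.den` modulo `p`.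
  refine ⟨n * p * r.den - r.den - p * r.num, r.den, fun h ↦ ?_, ?_⟩
  · have h1 : (p : ℤ) ∣ r.den := by
      have h3 : (p : ℤ) ∣ p * (n * r.den - r.num) := Dvd.intro _ rfl
      have := dvd_sub h3 h
      ring_nf at this
      exact this
    exact hp.one_lt.ne' (hcop.symm.eq_one_of_dvd (Int.natCast_dvd_natCast.mp h1))
  · have hp0 : (p : ℚ) ≠ 0 := by exact_mod_cast hp.ne_zero
    have hd : (r.den : ℚ) ≠ 0 := by exact_mod_cast r.den_nz
    have hrr : r * r.den = r.num := Rat.mul_den_eq_num r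
    have hp1 : (1 : ℚ) / p * p = 1 := by field_simp
    push_cast
    linear_combination (-(p : ℚ) * r.den) * hn - r.den * hp1 - p * hrr

/-- Reduction of integral power series modulo `p`. -/
noncomputable abbrev red (p : ℕ) : ℤ⟦X⟧ →+* (ZMod p)⟦X⟧ := PowerSeries.map (Int.castRingHom (ZMod p))

lemma constantCoeff_red (p : ℕ) (a : ℤ⟦X⟧) :
    constantCoeff (red p a) = ((constantCoeff a : ℤ) : ZMod p) := by
  rw [← coeff_zero_eq_constantCoeff_apply, coeff_map, coeff_zero_eq_constantCoeff_apply, eq_intCast]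

/-- There is an integral form of weight `p - 1` congruent to `1` modulo `p`. -/
lemma exists_red_eq_one {p : ℕ} [Fact p.Prime] (hp : 3 < p) :
    ∃ a : ℤ⟦X⟧, IsModularSeries (p - 1) (toC a) ∧ red p a = 1 := by
  have hpp : p.Prime := Fact.out
  obtain ⟨M, D, hM, h⟩ := exists_bernoulli_mul_eq hpp (by omega)
  have hev : Even (p - 1) := hpp.even_sub_one (by omega)
  have hM0 : (M : ℂ) ≠ 0 := by
    rintro h
    exact hM (by rw [Int.cast_eq_zero.mp h]; exact dvd_zero _)
  have hC : (bernoulli (p - 1) : ℂ) * (p * D) = M := by exact_mod_cast congr_arg (Rat.cast (K := ℂ)) h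
  have hB0 : (bernoulli (p - 1) : ℂ) ≠ 0 := left_ne_zero_of_mul (hC ▸ hM0)
  -- This is `M ^ (p - 1) * E_{p-1}`. One factor `M` clears `1 / B = p * D / M`; the full power
  -- makes the constant term `1` modulo `p` by Fermat.
  refine ⟨PowerSeries.mk fun m ↦ if m = 0 then M ^ (p - 1) else
    -2 * (p - 1) * (p * D) * M ^ (p - 2) * ArithmeticFunction.sigma (p - 1 - 1) m, ?_, ?_⟩
  · have hE : IsModularSeries ((p - 1 : ℕ) : ℤ) _ :=
      ⟨ModularForm.E (k := p - 1) (by omega), rfl⟩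
    convert! (hE.C_mul ((M : ℂ) ^ (p - 1))).cast (l := p - 1) (by omega) using 1
    ext m
    rw [coeff_map, coeff_mk, coeff_C_mul, EisensteinSeries.E_qExpansion_coeff _ hev]
    split_ifs
    · simp
    · have e : (M : ℂ) ^ (p - 1) = M ^ (p - 2) * M := by
        rw [← pow_succ]
        congr 1
        omega
      have hcast : ((p - 1 : ℕ) : ℂ) = p - 1 := by
        rw [Nat.cast_sub hpp.one_le, Nat.cast_one]
      have hq : (M : ℂ) * (2 * (p - 1) / bernoulli (p - 1)) = 2 * (p - 1) * (p * D) := by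
        rw [← hC]
        field_simp
      rw [e, hcast]
      simp only [eq_intCast]
      push_cast
      linear_combination ((M : ℂ) ^ (p - 2) * ArithmeticFunction.sigma (p - 1 - 1) m) * hq
  · ext m
    rw [coeff_map, coeff_mk, coeff_one]
    split_ifs
    · have : (M : ZMod p) ≠ 0 := fun h ↦ hM ((ZMod.intCast_zmod_eq_zero_iff_dvd _ _).mp h)
      simpa using ZMod.pow_card_sub_one_eq_one this
    · simp

/-! ### The residue theorem over `ℤ` and modulo `p` -/

lemma coeff_mul_eulerInv_pow_eq_zero_int (m : ℕ) {a : ℤ⟦X⟧}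
    (ha : IsModularSeries (12 * m + 2) (toC a)) : (a * eulerInv ^ (24 * m)).coeff m = 0 := by
  have h := coeff_mul_eulerInv_pow_eq_zero m ha
  rw [← map_pow, ← map_mul, coeff_map, eq_intCast] at h
  exact_mod_cast h

lemma coeff_red_mul_eulerInv_pow_eq_zero {p : ℕ} [Fact p.Prime] (hp : 3 < p) (m j : ℕ) {w : ℤ}
    {a : ℤ⟦X⟧} (ha : IsModularSeries w (toC a)) (hw : w + j * (p - 1) = 12 * m + 2) :
    (red p (a * eulerInv ^ (24 * m))).coeff m = 0 := by
  obtain ⟨b, hb, hb1⟩ := exists_red_eq_one hp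
  have h := coeff_mul_eulerInv_pow_eq_zero_int m (a := a * b ^ j) <| by
    rw [map_mul, map_pow]
    exact (ha.mul (hb.pow j)).cast hw
  have h1 : red p (a * eulerInv ^ (24 * m)) = red p (a * b ^ j * eulerInv ^ (24 * m)) := by
    simp only [map_mul, map_pow, hb1, one_pow, mul_one]
  rw [h1, coeff_map, h, map_zero]

/-! ### Duality -/

/-- `T` pairs trivially with every integral weakly holomorphic form of weight `2 - w`. -/
def Annihilates (p : ℕ) (w : ℤ) (T : (ZMod p)⟦X⟧) : Prop :=
  ∀ (m : ℕ) (a : ℤ⟦X⟧), IsModularSeries (12 * m + 2 - w) (toC a) →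
    (T * red p (a * eulerInv ^ (24 * m))).coeff m = 0

lemma IsModularSeries.annihilates {w : ℤ} {b : ℤ⟦X⟧} (hb : IsModularSeries w (toC b)) (p : ℕ) :
    Annihilates p w (red p b) := fun m a ha ↦ by
  have h := coeff_mul_eulerInv_pow_eq_zero_int m (a := b * a) <| by
    rw [map_mul]
    exact (hb.mul ha).cast (by ring)
  rw [← map_mul, ← mul_assoc, coeff_map, h, map_zero]

lemma coeff_mul_of_forall_lt {R : Type*} [CommRing R] {T : R⟦X⟧} {n : ℕ}
    (hT : ∀ i < n, T.coeff i = 0) (U : R⟦X⟧) :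
    (T * U).coeff n = T.coeff n * constantCoeff U := by
  obtain ⟨V, rfl⟩ := X_pow_dvd_iff.mpr hT
  rw [mul_assoc, coeff_X_pow_mul', coeff_X_pow_mul', if_pos le_rfl, if_pos le_rfl]
  simp

/-- The condition on `n` says exactly that weight `12 * n + 2 - w` contains a form `a` with constant
term `1`. Pairing `red p b - T` with `a / Δ ^ n` then isolates the coefficient of index `n`. -/
lemma Annihilates.coeff_eq_of_forall_lt {p : ℕ} {w : ℤ} (hw : Even w) {T : (ZMod p)⟦X⟧}
    (hT : Annihilates p w T) {b : ℤ⟦X⟧} (hb : IsModularSeries w (toC b)) {n : ℕ}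
    (hn : w - 12 * n < 0 ∨ w - 12 * n = 2) (h : ∀ i < n, (red p b).coeff i = T.coeff i) :
    (red p b).coeff n = T.coeff n := by
  obtain ⟨a, ha, ha0⟩ := exists_constantCoeff_eq_one (v := 12 * n + 2 - w)
    (by obtain ⟨u, rfl⟩ := hw; exact ⟨6 * n + 1 - u, by ring⟩) (by omega) (by omega)
  have h1 := hT n a ha
  have h2 := hb.annihilates p n a ha
  have h3 := coeff_mul_of_forall_lt (T := red p b - T) (n := n)
    (fun i hi ↦ by rw [map_sub, h i hi, sub_self]) (red p (a * eulerInv ^ (24 * n)))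
  have h4 : constantCoeff (red p (a * eulerInv ^ (24 * n))) = 1 := by
    simp only [constantCoeff_red, map_mul, map_pow, ha0, constantCoeff_eulerInv]
    simp
  rw [sub_mul, map_sub, h1, h2, h4, mul_one, sub_self, map_sub] at h3
  exact sub_eq_zero.mp h3.symm

/-- A power series modulo `p` annihilating the weakly holomorphic forms of weight `2 - w` is the
reduction of an integral modular form of weight `w`. -/
theorem Annihilates.exists_red_eq {p : ℕ} {w : ℤ} (hw : Even w) {T : (ZMod p)⟦X⟧}
    (hT : Annihilates p w T) : ∃ b : ℤ⟦X⟧, IsModularSeries w (toC b) ∧ red p b = T := by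
  have key (n : ℕ) : ∃ b : ℤ⟦X⟧, IsModularSeries w (toC b) ∧
      ∀ i < n, (red p b).coeff i = T.coeff i := by
    induction n with
    | zero => exact ⟨0, by simpa using IsModularSeries.zero w, by simp⟩
    | succ n ih =>
      obtain ⟨b, hb, h⟩ := ih
      by_cases hn : w - 12 * n < 0 ∨ w - 12 * n = 2
      · refine ⟨b, hb, fun i hi ↦ ?_⟩
        rcases Nat.lt_succ_iff_lt_or_eq.mp hi with hi | rfl
        · exact h i hi
        · exact hT.coeff_eq_of_forall_lt hw hb hn h
      -- In the complementary case `Δ ^ n * d` has weight `w` and leading term `q ^ n`, so a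
      -- multiple of it corrects the coefficient of index `n` and no earlier one.
      · obtain ⟨d, hd, hd0⟩ := exists_constantCoeff_eq_one (v := w - 12 * n)
          (by obtain ⟨u, rfl⟩ := hw; exact ⟨u - 6 * n, by ring⟩) (by omega) (by omega)
        obtain ⟨c, hc⟩ := ZMod.intCast_surjective (T.coeff n - (red p b).coeff n)
        refine ⟨b + C c * ((X * euler ^ 24) ^ n * d), ?_, fun i hi ↦ ?_⟩
        · have h1 := (((isModularSeries_discriminant.pow n).mul hd).C_mul c).cast (l := w) (by ring)
          simpa using hb.add (by simpa using h1)
        · have e : red p (b + C c * ((X * euler ^ 24) ^ n * d)) =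
              red p b + X ^ n * red p (C c * (euler ^ 24) ^ n * d) := by
            simp only [map_add, map_mul, map_pow, map_X, mul_pow]
            ring
          rw [e, map_add, coeff_X_pow_mul']
          rcases Nat.lt_succ_iff_lt_or_eq.mp hi with hi | rfl
          · rw [if_neg (by omega), h i hi, add_zero]
          · rw [if_pos le_rfl, Nat.sub_self, coeff_zero_eq_constantCoeff_apply,
              constantCoeff_red]
            simp only [map_mul, map_pow, constantCoeff_C, constantCoeff_euler, hd0, one_pow, mul_one,
              hc]
            ring
  -- For `n > w.toNat` the weight `w - 12 * n` is negative, so all later coefficients are forced.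
  obtain ⟨b, hb, h⟩ := key (w.toNat + 1)
  refine ⟨b, hb, PowerSeries.ext fun n ↦ ?_⟩
  induction n using Nat.strong_induction_on with | _ n ih =>
  by_cases hn : n < w.toNat + 1
  · exact h n hn
  · exact hT.coeff_eq_of_forall_lt hw hb (by omega) ih

/-! ### Sections of power series -/

lemma pow_eq_expand {p : ℕ} [Fact p.Prime] (Y : (ZMod p)⟦X⟧) :
    Y ^ p = expand p (Fact.out : p.Prime).ne_zero Y := by
  have h := MvPowerSeries.map_frobenius_expand (σ := Unit) (R := ZMod p) p
    (Fact.out : p.Prime).ne_zero (f := Y)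
  rw [ZMod.frobenius_zmod] at h
  refine h.symm.trans ?_
  ext n
  rfl

/-- The projection formula for sections: only exponents divisible by `p` occur in `expand p hp Y`,
so the exponent taken from `f` is congruent to `β`. -/
lemma coeff_mk_mul {R : Type*} [CommRing R] {p β : ℕ} (hp : p ≠ 0) (hβ : β < p) (f Y : R⟦X⟧)
    (m : ℕ) : ((PowerSeries.mk fun n ↦ f.coeff (p * n + β)) * Y).coeff m =
      (f * expand p hp Y).coeff (p * m + β) := by
  rw [coeff_mul, coeff_mul]
  refine Finset.sum_of_injOn (fun x ↦ (p * x.1 + β, p * x.2)) ?_ ?_ ?_ ?_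
  · rintro ⟨a, b⟩ - ⟨c, d⟩ - h
    simpa [hp] using h
  · rintro ⟨a, b⟩ h
    simp only [Finset.HasAntidiagonal.mem_antidiagonal, Finset.mem_coe] at h ⊢
    rw [← h]
    ring
  · rintro ⟨a, b⟩ h h'
    rw [Finset.HasAntidiagonal.mem_antidiagonal] at h
    dsimp only at h ⊢
    rw [coeff_expand_of_not_dvd, mul_zero]
    rintro ⟨d, rfl⟩
    have hdm : d ≤ m := by
      -- Here `β < p` enters: `d > m` would give `p * d > p * m + β`.
      by_contra! hlt
      have : p * (m + 1) ≤ p * d := Nat.mul_le_mul_left p hlt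
      rw [mul_add] at this
      omega
    refine h' ⟨(m - d, d), by simp [hdm], ?_⟩
    obtain ⟨e, rfl⟩ := Nat.exists_eq_add_of_le hdm
    rw [mul_add] at h
    simp only [Prod.mk.injEq, and_true, Nat.add_sub_cancel_left]
    omega
  · rintro ⟨a, b⟩ h
    simp [coeff_expand_mul]

/-! ### The congruence -/

lemma p_eq_coeff {k : ℤ} (F : ModularForm 𝒮ℒ k) {a : ℤ⟦X⟧} (ha : qExpansion 1 F = toC a) (n : ℕ) :
    p F n = ((a * eulerInv).coeff n : ℤ) := by
  have h := ((hasQExp_modularForm F).mul hasQExp_eulerInv).qExpansion_eq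
  rw [ha, ← map_mul] at h
  rw [← eq_intCast (Int.castRingHom ℂ), ← coeff_map, ← h]
  rfl

lemma IsIntegralForm.exists_eq_toC {k : ℤ} {F : ModularForm 𝒮ℒ k} (hF : IsIntegralForm F) :
    ∃ a : ℤ⟦X⟧, qExpansion 1 F = toC a := by
  choose a ha using hF
  exact ⟨PowerSeries.mk a, by ext n; simp [ha]⟩

lemma isIntegralForm_of_eq_toC {k : ℤ} {F : ModularForm 𝒮ℒ k} {a : ℤ⟦X⟧}
    (h : qExpansion 1 F = toC a) : IsIntegralForm F := fun n ↦ ⟨a.coeff n, by simp [h]⟩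

lemma seriesCongr_of_red_eq {m : ℕ} {a b : ℤ⟦X⟧} (h : red m a = red m b) :
    SeriesCongr m (toC a) (toC b) := fun n ↦ by
  refine ⟨a.coeff n, b.coeff n, by simp, by simp, ?_⟩
  rw [← ZMod.intCast_eq_intCast_iff]
  simpa using congr_arg (coeff n) h

/-- The exponent `k + (l - 5) / 2` of the form congruent to `1` is what brings the total weight to
`12 * (l * m + b) + 2`. The natural-number division is exact, as `l` is odd and at least `5`. -/
lemma weight_identity {l b lam : ℕ} (k m : ℕ) (hodd : Odd l) (h3 : 3 < l) (hb : 1 ≤ b)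
    (h : 24 * l * lam = l ^ 2 + 24 * b - 1) :
    (k : ℤ) + l * (12 * m + 2 - (k + l - 1 - 12 * lam)) + (k + (l - 5) / 2 : ℕ) * (l - 1) =
      12 * (l * m + b : ℕ) + 2 := by
  obtain ⟨c, rfl⟩ := hodd
  obtain ⟨d, rfl⟩ : ∃ d, c = d + 2 := ⟨c - 2, by omega⟩
  have e : (2 * (d + 2) + 1 - 5) / 2 = d := by omega
  have h' : 24 * (2 * (d + 2) + 1) * lam + 1 = (2 * (d + 2) + 1) ^ 2 + 24 * b := by omega
  rw [e]
  zify at h'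
  push_cast
  linarith

/-- The section `∑ p(F, l * n + b) q ^ n`, divided by `∏ (1 - q ^ n) ^ r`, annihilates weakly
holomorphic forms. -/
lemma annihilates_section {l b r lam : ℕ} [Fact l.Prime] (h3 : 3 < l) (hb1 : 1 ≤ b)
    (hb2 : b < l) (hr : l * r = 24 * b - 1) (hlam : 24 * l * lam = l ^ 2 + 24 * b - 1) {k : ℕ}
    {a : ℤ⟦X⟧} (ha : IsModularSeries k (toC a)) :
    Annihilates l (k + l - 1 - 12 * lam)
      (red l ((PowerSeries.mk fun n ↦ (a * eulerInv).coeff (l * n + b)) * eulerInv ^ r)) := by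
  intro m c hc
  have hl : l.Prime := Fact.out
  have h := coeff_red_mul_eulerInv_pow_eq_zero h3 (l * m + b) (k + (l - 5) / 2)
    (a := a * c ^ l) (by rw [map_mul, map_pow]; exact ha.mul (hc.pow l))
    (weight_identity k m (hl.eq_two_or_odd'.resolve_left (by omega)) h3 hb1 hlam)
  have hS : red l (PowerSeries.mk fun n ↦ (a * eulerInv).coeff (l * n + b)) =
      PowerSeries.mk fun n ↦ (red l (a * eulerInv)).coeff (l * n + b) := by
    ext n
    simp only [coeff_map, coeff_mk]
  rw [(red l).map_mul, mul_assoc, hS, coeff_mk_mul hl.ne_zero hb2, ← pow_eq_expand, ← h,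
    ← (red l).map_mul, ← (red l).map_pow, ← (red l).map_mul]
  congr 2
  -- The exponents of `eulerInv`: `1` from the partition series, and `r` and `24 * m` multiplied by
  -- `l` through Frobenius.
  have e : 24 * (l * m + b) = 1 + l * r + l * (24 * m) := by
    have : 24 * (l * m + b) = 24 * b + l * (24 * m) := by ring
    omega
  rw [e]
  ring

end ChuaCongruence

theorem theorem3p4 (ℓ : ℕ) (hℓ : ℓ.Prime) (hℓ3 : 3 < ℓ) (k : ℕ) (hk : Even k)
    (F : ModularForm 𝒮ℒ (k : ℤ)) (hF : ChuaCongruence.IsIntegralForm F)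
    (β : ℕ) (hβ1 : 1 ≤ β) (hβ2 : β ≤ ℓ - 1) (hβ : 24 * β ≡ 1 [MOD ℓ]) :
    ∃ G : ModularForm 𝒮ℒ ((k : ℤ) + (ℓ : ℤ) - 1 - 12 * (ChuaCongruence.lamNum ℓ β : ℤ)),
      ChuaCongruence.IsIntegralForm G ∧
      ChuaCongruence.SeriesCongr ℓ
        (ChuaCongruence.series24 (ChuaCongruence.rNum ℓ β)
          fun n : ℕ ↦ ChuaCongruence.p F (ℓ * n + β))
        (UpperHalfPlane.qExpansion 1 fun τ : ℍ ↦
          ModularForm.eta (ChuaCongruence.mul24 τ : ℂ) ^ ChuaCongruence.rNum ℓ β *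
            G (ChuaCongruence.mul24 τ)) := by
  open ChuaCongruence PowerSeries in
  have : Fact ℓ.Prime := ⟨hℓ⟩
  obtain ⟨a, ha⟩ := hF.exists_eq_toC
  have hodd := hℓ.eq_two_or_odd'.resolve_left (by omega)
  have hw : Even ((k : ℤ) + ℓ - 1 - 12 * lamNum ℓ β) := by
    obtain ⟨u, rfl⟩ := hk
    obtain ⟨v, rfl⟩ := hodd
    exact ⟨u + v - 6 * lamNum (2 * v + 1) β, by push_cast; ring⟩
  set r := rNum ℓ β
  set S : ℤ⟦X⟧ := PowerSeries.mk fun n ↦ (a * eulerInv).coeff (ℓ * n + β) with hS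
  obtain ⟨b, ⟨G, hG⟩, hb⟩ := (annihilates_section hℓ3 hβ1 (by omega) (rNum_spec hβ1 hβ)
    (lamNum_spec hℓ hℓ3 hβ1 hβ) ⟨F, ha⟩).exists_red_eq hw
  refine ⟨G, isIntegralForm_of_eq_toC hG, ?_⟩
  have hleft : series24 r (fun n ↦ p F (ℓ * n + β)) =
      toC (X ^ r * expand 24 (by norm_num) S) := by
    rw [series24, map_mul, map_pow, map_X, map_expand]
    congr 2
    ext n
    simp [p_eq_coeff F ha, hS]
  have hright := HasQExp.qExpansion_eq ((hasQExp_eta_mul24.pow r).mul (hG ▸ hasQExp_modularForm G).comp_mul24)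
  have hright' : (X * expand 24 (by norm_num) (toC euler)) ^ r * expand 24 (by norm_num) (toC b) =
      toC (X ^ r * expand 24 (by norm_num) (euler ^ r * b)) := by
    simp only [map_mul, map_pow, map_X, map_expand, mul_pow, mul_assoc]
  rw [hleft]
  refine (hright.trans hright').symm ▸ seriesCongr_of_red_eq ?_
  -- The factor `euler ^ r` from `η ^ r` cancels the twist `eulerInv ^ r` built into `b`.
  have hi : red ℓ euler * red ℓ eulerInv = 1 := by rw [← map_mul, euler_mul_eulerInv, map_one]
  have hSb : red ℓ S = red ℓ (euler ^ r * b) := by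
    rw [map_mul, hb, map_mul, map_pow, map_pow, mul_left_comm, ← mul_pow, hi, one_pow, mul_one]
  rw [map_mul, map_mul, map_expand, map_expand, hSb]
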